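/- **Proposition (a negative-pedal porism).** Let $\mathcal T$ be a nondegenerate triangle in the Euclidean plane with circumcircle $\mathcal C$, and let $D$ be a point lying neither on a side line of $\mathcal T$ nor on $\mathcal C$. For a point $P\ne D$ let $\ell_P$ denote the perpendicular to $DP$ at $P$. Let $\mathcal T_D$ be the negative-pedal triangle of $\mathcal T$ (the triangle whose side lines are the lines $\ell_P$, $P$ running over the vertices of $\mathcal T$), and let $\mathcal C_D$ be its circumcircle. The pedal circle of a triangle is the circumcircle of the triangle formed by the orthogonal projections of $D$ onto its side lines. "The conic inscribed in $\mathcal T$ with focus $D$" is the nondegenerate conic with focus $D$ that has the three side lines of $\mathcal T$ as tangents (an asymptote counts as a tangent). The inside of a conic is the region, or for a hyperbola the two regions, that it bounds and that contain its foci. (1) Let $A\in\mathcal C$ be such that $\ell_A$ meets $\mathcal C_D$ in two distinct points $B',C'$. The circles of diameters $[B'D]$ and $[C'D]$ pass through $A$. Let $C$ and $B$, respectively, be their second intersections with $\mathcal C$ (the second intersection is $A$ itself if the circle is tangent to $\mathcal C$ at $A$). Then the lines $BC'$ and $CB'$ (to be read as $\ell_B$ if $B=C'$, and as $\ell_C$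 if $C=B'$) meet in exactly one point $A'$, and i) $A'$ lies on $\mathcal C_D$; ii) if $B\ne A$ and $C\ne A$, then $A',B',C'$ are the vertices of a nondegenerate triangle which shares with $\mathcal T_D$ the same circumcircle $\mathcal C_D$ and the same pedal circle $\mathcal C$ with respect to $D$. (2) If $A\in\mathcal C$ and $\ell_A$ does not meet $\mathcal C_D$ in two distinct points, then there is no triangle inscribed in $\mathcal C$ with a vertex at $A$ whose negative-pedal triangle with respect to $D$ has circumcircle $\mathcal C_D$. (3) There is exactly one conic $\gamma_D$ inscribed in $\mathcal T$ with focus $D$. For $A\in\mathcal C$, the line $\ell_A$ does not meet $\mathcal C_D$ in two distinct points if and only if $A$ lies inside or on $\gamma_D$; that is, if and only if $A$ lies on one of the closed (infertile) arcs, possibly reduced to a point, that $\gamma_D$ and its inside cut out of $\mathcal C$. -/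

import Mathlib

open scoped RealInnerProductSpace

namespace PedalPorism

/-- The Euclidean plane. -/
abbrev Plane : Type := EuclideanSpace ℝ (Fin 2)

/-- The perpendicular to the line `D A` erected at the point `A` (a line when `A ≠ D`). -/
noncomputable def perpLine (D A : Plane) : AffineSubspace ℝ Plane :=
  AffineSubspace.mk' A (Submodule.span ℝ {A -ᵥ D})ᗮ

/-- The line `P X`, for a point `P` on the circle of diameter `[X D]`. If `P = X`, two points do
not determine a line and the limiting position, the perpendicular to `D P` at `P`, is meant
(by Thales' theorem the line `P X` is this perpendicular also when `P ≠ X`). -/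
noncomputable def joinLine (D P X : Plane) : AffineSubspace ℝ Plane :=
  open Classical in if P = X then perpLine D P else line[ℝ, P, X]

/-- `T'` is the negative-pedal triangle of `T` with respect to `D`: for each `i`, the side line
of `T'` opposite to its `i`-th vertex (the line through the two other vertices) is the
perpendicular to `D Tᵢ` at the `i`-th vertex `Tᵢ` of `T`. -/
def IsNegativePedalTriangle (D : Plane) (T T' : Affine.Triangle ℝ Plane) : Prop :=
  ∀ i j, j ≠ i → T'.points j ∈ perpLine D (T.points i)

/-- The negative-pedal triangle exists when `D` is neither on the side lines of `T` nor on its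
circumcircle. -/
theorem exists_isNegativePedalTriangle (D : Plane) (T : Affine.Triangle ℝ Plane)
    (hside : ∀ i j, i ≠ j → D ∉ line[ℝ, T.points i, T.points j])
    (hcirc : D ∉ T.circumsphere) :
    ∃ T' : Affine.Triangle ℝ Plane, IsNegativePedalTriangle D T T' := by
  -- normals of the side lines
  have key : ∀ P Q : Plane, P ≠ Q → D ∉ line[ℝ, P, Q] →
      ∃ n : Plane, ⟪n, P - D⟫ = 1 ∧ ⟪n, Q - D⟫ = 1 := by
    intro P Q hPQ h
    have hdet : (P 0 - D 0) * (Q 1 - D 1) - (P 1 - D 1) * (Q 0 - D 0) ≠ 0 := by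
      intro h0
      apply h
      suffices hs : ∃ t : ℝ, AffineMap.lineMap P Q t = D by
        obtain ⟨t, ht⟩ := hs
        have := AffineMap.lineMap_mem_affineSpan_pair t P Q
        rwa [ht] at this
      by_cases hx : Q 0 - P 0 = 0
      · have hy : Q 1 - P 1 ≠ 0 := by
          intro hy
          apply hPQ
          ext i
          fin_cases i <;> simp <;> linarith
        refine ⟨(D 1 - P 1) / (Q 1 - P 1), ?_⟩
        have hk : (D 0 - P 0) * (Q 1 - P 1) = 0 := by
          linear_combination -h0 + (D 1 - P 1) * hx
        have hk' : D 0 - P 0 = 0 := by simpa [hy] using hk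
        ext i
        fin_cases i
        · simp [AffineMap.lineMap_apply, hx]; linarith
        · simp [AffineMap.lineMap_apply]; field_simp; ring
      · refine ⟨(D 0 - P 0) / (Q 0 - P 0), ?_⟩
        ext i
        fin_cases i
        · simp [AffineMap.lineMap_apply]; field_simp; ring
        · simp [AffineMap.lineMap_apply]; field_simp; linear_combination -h0
    obtain ⟨d, hd⟩ : ∃ d, d = (P 0 - D 0) * (Q 1 - D 1) - (P 1 - D 1) * (Q 0 - D 0) := ⟨_, rfl⟩
    rw [← hd] at hdet
    refine ⟨!₂[((Q 1 - D 1) - (P 1 - D 1)) / d, ((P 0 - D 0) - (Q 0 - D 0)) / d], ?_, ?_⟩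
    · simp [PiLp.inner_apply, Fin.sum_univ_two]; field_simp; linear_combination -hd
    · simp [PiLp.inner_apply, Fin.sum_univ_two]; field_simp; linear_combination -hd
  have hn : ∀ i : Fin 3, ∃ n : Plane, ∀ j, j ≠ i → ⟪n, T.points j - D⟫ = 1 := by
    have hp : ∀ i j : Fin 3, i ≠ j → T.points i ≠ T.points j := fun i j h e =>
      h (T.independent.injective e)
    intro i
    fin_cases i
    · obtain ⟨n, h1, h2⟩ := key _ _ (hp 1 2 (by decide)) (hside 1 2 (by decide))
      exact ⟨n, fun j hj => by fin_cases j <;> simp_all⟩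
    · obtain ⟨n, h1, h2⟩ := key _ _ (hp 0 2 (by decide)) (hside 0 2 (by decide))
      exact ⟨n, fun j hj => by fin_cases j <;> simp_all⟩
    · obtain ⟨n, h1, h2⟩ := key _ _ (hp 0 1 (by decide)) (hside 0 1 (by decide))
      exact ⟨n, fun j hj => by fin_cases j <;> simp_all⟩
  choose n hn using hn
  have hn' : ∀ i, ⟪n i, T.points i - D⟫ ≠ 1 := by
    intro i hi
    have htop : affineSpan ℝ (Set.range T.points) = ⊤ :=
      T.independent.affineSpan_eq_top_iff_card_eq_finrank_add_one.2 (by simp)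
    have hD : D ∈ affineSpan ℝ (Set.range T.points) := by rw [htop]; trivial
    obtain ⟨w, hw, hDw⟩ := eq_affineCombination_of_mem_affineSpan_of_fintype hD
    have h0 : ∑ j, w j • (T.points j - D) = 0 := by
      simp only [smul_sub, Finset.sum_sub_distrib, ← Finset.sum_smul, hw, one_smul]
      rw [Finset.affineCombination_eq_linear_combination _ _ _ hw] at hDw
      rw [← hDw, sub_self]
    have h1 : ⟪n i, ∑ j, w j • (T.points j - D)⟫ = 1 := by
      rw [inner_sum, ← hw]
      refine Finset.sum_congr rfl fun j _ => ?_
      rw [inner_smul_right]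
      by_cases hj : j = i
      · rw [hj, hi, mul_one]
      · rw [hn i j hj, mul_one]
    rw [h0, inner_zero_right] at h1
    exact zero_ne_one h1
  set O := T.circumsphere.center with hO
  set r := T.circumsphere.radius with hr
  set l : ℝ := r ^ 2 - ‖D - O‖ ^ 2 with hl
  have hl0 : l ≠ 0 := by
    intro h
    apply hcirc
    rw [EuclideanGeometry.mem_sphere, dist_eq_norm]
    have hr0 : 0 ≤ r := T.circumradius_nonneg
    exact (sq_eq_sq₀ (norm_nonneg _) hr0).1 (by linarith)
  have hP : ∀ i, ‖T.points i - D‖ ^ 2 - 2 * ⟪O - D, T.points i - D⟫ = l := by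
    intro i
    have h1 := EuclideanGeometry.mem_sphere.1 (T.mem_circumsphere i)
    rw [dist_eq_norm, ← hO, ← hr] at h1
    have h2 : T.points i - O = (T.points i - D) - (O - D) := by abel
    rw [hl, ← h1, h2, norm_sub_sq_real (T.points i - D) (O - D), norm_sub_rev D O,
      real_inner_comm (O - D) (T.points i - D)]
    ring
  let p : Fin 3 → Plane := fun i => D + l • n i + (2 : ℝ) • (O - D)
  have hp : ∀ i j, ⟪p j - T.points i, T.points i - D⟫ = l * (⟪n j, T.points i - D⟫ - 1) := by
    intro i j
    have h2 : p j - T.points i = l • n j + (2 : ℝ) • (O - D) - (T.points i - D) := by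
      simp only [p]; abel
    rw [h2, inner_sub_left, inner_add_left, inner_smul_left, inner_smul_left,
      real_inner_self_eq_norm_sq]
    simp only [conj_trivial]
    linear_combination -(hP i)
  have hind : AffineIndependent ℝ p := by
    rw [affineIndependent_iff]
    intro s w hw hs i hi
    have h1 : ⟪∑ j ∈ s, w j • p j, T.points i - D⟫ = 0 := by rw [hs, inner_zero_left]
    have h2 : ⟪∑ j ∈ s, w j • (p j - T.points i), T.points i - D⟫ = 0 := by
      simp only [smul_sub, Finset.sum_sub_distrib, ← Finset.sum_smul, hw, zero_smul, sub_zero]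
      exact h1
    rw [sum_inner, Finset.sum_eq_single i] at h2
    · rw [inner_smul_left, hp] at h2
      have := sub_ne_zero.2 (hn' i)
      simpa [hl0, this] using h2
    · intro j _ hj
      rw [inner_smul_left, hp, hn j i hj.symm]
      simp
    · exact fun h => absurd hi h
  refine ⟨⟨p, hind⟩, fun i j hj => ?_⟩
  rw [perpLine, AffineSubspace.mem_mk', Submodule.mem_orthogonal_singleton_iff_inner_left]
  show ⟪p j - T.points i, T.points i - D⟫ = 0
  rw [hp, hn j i hj.symm]
  simp

/-- `S` is the pedal circle of `T` with respect to `D`: the circumcircle of the triangle whose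
vertices are the orthogonal projections of `D` onto the side lines of `T`. -/
def IsPedalCircle (D : Plane) (T : Affine.Triangle ℝ Plane)
    (S : EuclideanGeometry.Sphere Plane) : Prop :=
  ∃ t : Affine.Triangle ℝ Plane,
    (∀ i, t.points i = (T.faceOpposite i).orthogonalProjectionSpan D) ∧ t.circumsphere = S

/-- A nondegenerate conic with a distinguished focus `F`, in focal form: the locus of the points
`X` with `|X F| = |p + ⟪w, X - F⟫|`, `p > 0`. For `w = 0` this is the circle with centre `F` and
radius `p`; for `w ≠ 0` it is the conic with focus `F`, directrix `p + ⟪w, X - F⟫ = 0` and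
eccentricity `‖w‖` (both branches, if it is a hyperbola). -/
structure FocalConic where
  focus : Plane
  w : Plane
  p : ℝ
  p_pos : 0 < p

namespace FocalConic

/-- The quadratic function whose zero set is the conic. -/
noncomputable def eqn (γ : FocalConic) (X : Plane) : ℝ :=
  dist X γ.focus ^ 2 - (γ.p + ⟪γ.w, X - γ.focus⟫) ^ 2

/-- The points of the conic. -/
def carrier (γ : FocalConic) : Set Plane := {X | γ.eqn X = 0}

/-- The inside of the conic: the region bounded by the conic that contains its foci (for a
hyperbola, the union of the two convex regions bounded by its branches). -/
def inside (γ : FocalConic) : Set Plane := {X | γ.eqn X < 0}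

/-- The line through the distinct points `P` and `Q` is a tangent of the conic: it meets the conic
in a double point, which may be at infinity (that is, an asymptote of a hyperbola is a tangent).
Along the line the equation of the conic is a polynomial `a t² + b t + c`, and this is
the vanishing of its discriminant. -/
def IsTangent (γ : FocalConic) (P Q : Plane) : Prop :=
  ∃ a b c : ℝ, (∀ t : ℝ, γ.eqn (AffineMap.lineMap P Q t) = a * t ^ 2 + b * t + c) ∧
    discrim a b c = 0

/-- The conic is inscribed in the triangle `T`: the three side lines of `T` are tangents. -/
def IsInscribedIn (γ : FocalConic) (T : Affine.Triangle ℝ Plane) : Prop :=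
  ∀ i j, i ≠ j → γ.IsTangent (T.points i) (T.points j)

end FocalConic

end PedalPorism

/-!
Identify the plane with `ℂ` in such a way that `C_D` becomes the unit circle, write `g` for `D` and
`f` for the reflection of `D` in the centre of `C`. A chord of the unit circle has the foot of its
perpendicular from `g` on `C` if and only if it is tangent to a fixed conic with foci `f` and `g`
(`C` is the pedal circle of that conic). For points `u, v` of the unit circle this tangency is a
symmetric biquadratic condition. The triples that close up are the fibres of the Blaschke product
`z (z - f) (z - g) / ((1 - z * star f) (1 - z * star g))`, and the existence of a single closing
triple forces the relation between `C` and `g` under which every tangent chord is a side of a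
closing triple; this is the porism.

For the inscribed conic, `ℓ_P ∩ ℓ_Q` is, up to a fixed translation or point reflection, the pole of
`PQ` with respect to a circle centred at `D`. So the chord `PQ` of `C` is tangent to a conic with
focus `D` if and only if `ℓ_P ∩ ℓ_Q` lies on a circle dual to the conic, and the conic is inscribed
in the triangle if and only if its dual circle is `C_D`.
-/

namespace PedalPorism

section UnitCircle

variable {K : Type*} [Field K] [StarRing K]

/-- Over the complex numbers the line through two points `u`, `v` of the unit circle, the tangent
if `u = v`, is the zero set of this form in `z`, and the modulus of the form is twice the distance
of `z` from that line. -/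
def chordForm (u v z : K) : K :=
  u + v - z - u * v * star z

/-- The chord `u v` of the unit circle is a tangent of a conic with foci `f` and `g`: up to the
factor `u * v` of modulus one, the product of the distances of the foci from the chord is
`|κ| / 4`. -/
def IsTangentChord (f g κ u v : K) : Prop :=
  chordForm u v f * chordForm u v g = κ * (u * v)

/-- A triangle inscribed in the unit circle and circumscribed about the conic with foci `f` and `g`
for which such triangles exist. Equivalently, `u`, `v` and `w` form a fibre of the Blaschke product
`z (z - f) (z - g) / ((1 - z * star f) (1 - z * star g))`. -/
structure IsPonceletTriple (f g u v w : K) : Prop where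
  mem_fst : u ∈ unitary K
  mem_snd : v ∈ unitary K
  mem_trd : w ∈ unitary K
  sum_eq : u + v + w = f + g + star f * star g * (u * v * w)

lemma mul_star_of_mem_unitary {u : K} (hu : u ∈ unitary K) : u * star u = 1 :=
  Unitary.mul_star_self_of_mem hu

lemma ne_zero_of_mem_unitary {u : K} (hu : u ∈ unitary K) : u ≠ 0 :=
  left_ne_zero_of_mul_eq_one (mul_star_of_mem_unitary hu)

lemma one_sub_mul_star_ne_zero {u f : K} (hu : u ∈ unitary K) (h : u ≠ f) :
    1 - u * star f ≠ 0 := by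
  rw [← mul_star_of_mem_unitary hu, ← mul_sub, ← star_sub]
  exact mul_ne_zero (ne_zero_of_mem_unitary hu) (star_ne_zero.2 (sub_ne_zero.2 h))

lemma sub_div_one_sub_mul_star_mem_unitary {u f : K} (hu : u ∈ unitary K) (h : u ≠ f) :
    (u - f) / (1 - u * star f) ∈ unitary K := by
  have hu1 := mul_star_of_mem_unitary hu
  have hden := one_sub_mul_star_ne_zero hu h
  have hden' : 1 - f * star u ≠ 0 := by
    simpa only [star_sub, star_one, star_mul, star_star] using star_ne_zero.2 hden
  rw [Unitary.mem_iff_self_mul_star]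
  simp only [star_div₀, star_sub, star_one, star_mul, star_star]
  field_simp
  linear_combination (1 - f * star f) * hu1

lemma ne_of_one_sub_mul_star_ne_zero {u f : K} (hu : u ∈ unitary K) (hf : 1 - f * star f ≠ 0) :
    u ≠ f := by
  rintro rfl
  exact hf (by rw [mul_star_of_mem_unitary hu, sub_self])

lemma IsTangentChord.symm {f g κ u v : K} (h : IsTangentChord f g κ u v) :
    IsTangentChord f g κ v u := by
  unfold IsTangentChord chordForm at *
  linear_combination h

lemma chordForm_mul_chordForm (f g u v : K) :
    chordForm u v f * chordForm u v g = (1 - f * star f) * (1 - g * star g) * (u * v)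
      + ((1 - u * star f) * (1 - u * star g) * v * (v + u - f - g)
        - (star f * star g * u * v - 1) * ((u - f) * (u - g))) := by
  unfold chordForm
  ring

namespace IsPonceletTriple

variable {f g u v w : K}

lemma swap (h : IsPonceletTriple f g u v w) : IsPonceletTriple f g v u w :=
  ⟨h.mem_snd, h.mem_fst, h.mem_trd, by linear_combination h.sum_eq⟩

lemma rotate (h : IsPonceletTriple f g u v w) : IsPonceletTriple f g v w u :=
  ⟨h.mem_snd, h.mem_trd, h.mem_fst, by linear_combination h.sum_eq⟩

lemma sum_mul_eq (h : IsPonceletTriple f g u v w) :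
    u * v + u * w + v * w = f * g + (star f + star g) * (u * v * w) := by
  have hu := mul_star_of_mem_unitary h.mem_fst
  have hv := mul_star_of_mem_unitary h.mem_snd
  have hw := mul_star_of_mem_unitary h.mem_trd
  have hstar := congrArg star h.sum_eq
  simp only [star_add, star_mul', star_star] at hstar
  linear_combination (u * v * w) * hstar + (f * g * u * v * star u * star v - u * v) * hw
    + (f * g * u * star u - u * w) * hv + (f * g - v * w) * hu

lemma isTangentChord (h : IsPonceletTriple f g u v w) :
    IsTangentChord f g ((1 - f * star f) * (1 - g * star g)) u v := by
  unfold IsTangentChord chordForm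
  linear_combination (u + v - u * v * (star f + star g)) * h.sum_eq
    - (1 - star f * star g * (u * v)) * h.sum_mul_eq

lemma blaschke (h : IsPonceletTriple f g u v w) :
    (u - f) * (u - g) = (1 - u * star f) * (1 - u * star g) * (v * w) := by
  linear_combination u * h.sum_eq - h.sum_mul_eq

/-- The vertices `v` and `w` are the roots of the quadratic equation that expresses tangency of a
chord through `u`. -/
lemma eq_or_eq_of_isTangentChord (h : IsPonceletTriple f g u v w) (huf : u ≠ f) (hug : u ≠ g)
    {x : K} (hx : IsTangentChord f g ((1 - f * star f) * (1 - g * star g)) u x) :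
    x = v ∨ x = w := by
  have hP : (1 - u * star f) * (1 - u * star g) ≠ 0 :=
    mul_ne_zero (one_sub_mul_star_ne_zero h.mem_fst huf) (one_sub_mul_star_ne_zero h.mem_fst hug)
  have hroots : (1 - u * star f) * (1 - u * star g) * ((x - v) * (x - w)) = 0 := by
    rw [IsTangentChord, chordForm_mul_chordForm] at hx
    linear_combination hx + (x * star f * star g * u - 1) * h.blaschke
      - x * (1 - u * star f) * (1 - u * star g) * h.sum_eq
  simpa [hP, sub_eq_zero] using hroots

end IsPonceletTriple

lemma exists_isPonceletTriple {f g u v : K} (huf : u ≠ f) (hug : u ≠ g)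
    (hu : u ∈ unitary K) (hv : v ∈ unitary K)
    (h : IsTangentChord f g ((1 - f * star f) * (1 - g * star g)) u v) :
    ∃ w, IsPonceletTriple f g u v w := by
  have hPf := one_sub_mul_star_ne_zero hu huf
  have hPg := one_sub_mul_star_ne_zero hu hug
  refine ⟨(u - f) / (1 - u * star f) * ((u - g) / (1 - u * star g)) * star v, hu, hv,
    mul_mem (mul_mem (sub_div_one_sub_mul_star_mem_unitary hu huf)
      (sub_div_one_sub_mul_star_mem_unitary hu hug)) (Unitary.star_mem hv), ?_⟩
  rw [IsTangentChord, chordForm_mul_chordForm] at h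
  apply mul_left_cancel₀ (ne_zero_of_mem_unitary hv)
  field_simp
  linear_combination h + (1 - star f * star g * u * v) * (u - f) * (u - g)
    * mul_star_of_mem_unitary hv

/-- Each vertex determines the defect `σ` of the closing relation up to a Blaschke factor;
comparing the three answers leaves no freedom for `κ`. -/
lemma eq_of_isTangentChord {f g κ u v w : K} (hw : w ≠ 0) (huv : u ≠ v) (huw : u ≠ w)
    (hvw : v ≠ w) (h_uv : IsTangentChord f g κ u v) (h_uw : IsTangentChord f g κ u w)
    (h_vw : IsTangentChord f g κ v w) :
    κ = (1 - f * star f) * (1 - g * star g) := by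
  obtain ⟨σ, hσ⟩ : ∃ σ, σ = u + v + w - f - g - star f * star g * (u * v * w) := ⟨_, rfl⟩
  have vertex : ∀ {a b c : K}, b ≠ c →
      σ = a + b + c - f - g - star f * star g * (a * b * c) →
      IsTangentChord f g κ a b → IsTangentChord f g κ a c →
      (1 - a * star f) * (1 - a * star g) * σ
        = (κ - (1 - f * star f) * (1 - g * star g)) * a := by
    intro a b c hbc hσ hab hac
    rw [IsTangentChord, chordForm_mul_chordForm] at hab hac
    apply mul_left_cancel₀ (sub_ne_zero.2 hbc)
    rw [hσ]
    linear_combination hab - hac - star f * star g * a * (c * hab - b * hac)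
  have hu' := vertex hvw hσ h_uv h_uw
  have hv' := vertex huw (by rw [hσ]; ring) h_uv.symm h_vw
  have hw' := vertex huv (by rw [hσ]; ring) h_uw.symm h_vw.symm
  have hσ0 : σ = 0 := by
    have : (u - v) * (u - w) * (v - w) * σ = 0 := by
      linear_combination v * w * (v - w) * hu' - u * w * (u - w) * hv' + u * v * (u - v) * hw'
    simpa [sub_eq_zero, huv, huw, hvw] using this
  exact sub_eq_zero.1 (by simpa [hσ0, hw] using hw'.symm)

end UnitCircle

section ComplexPlane

variable {g a u v w : ℂ}

lemma two_mul_inner_eq (x y : ℂ) : ((2 * ⟪x, y⟫ : ℝ) : ℂ) = x * star y + star x * y := by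
  rw [real_inner_comm, Complex.inner, ← Complex.add_conj, map_mul, Complex.conj_conj]
  rfl

lemma inner_eq_zero_iff_mul_star {x y : ℂ} : ⟪x, y⟫ = 0 ↔ x * star y + star x * y = 0 := by
  rw [← two_mul_inner_eq, Complex.ofReal_eq_zero, mul_eq_zero_iff_left two_ne_zero]

/-- The foot of the perpendicular from `g` to the chord through the points `u` and `v` of the unit
circle, to the tangent if `u = v`. -/
noncomputable def foot (g u v : ℂ) : ℂ :=
  (u + v + g - u * v * star g) / 2

lemma two_mul_foot_sub (g u v : ℂ) : 2 * (foot g u v - g) = chordForm u v g := by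
  unfold foot chordForm
  ring

lemma foot_comm (g u v : ℂ) : foot g u v = foot g v u := by
  unfold foot
  ring

lemma foot_sub_eq (hu : u ∈ unitary ℂ) (hv : v ∈ unitary ℂ) :
    foot g u v - g = u * v * star (foot g u v - g) := by
  have hu1 := mul_star_of_mem_unitary hu
  have hv1 := mul_star_of_mem_unitary hv
  have h2 : star (2 : ℂ) = 2 := star_ofNat 2
  simp only [foot, star_sub, star_div₀, star_add, star_mul', star_star, h2]
  linear_combination (g * v * star v - v) / 2 * hu1 + (g - u) / 2 * hv1

lemma inner_sub_foot (hu : u ∈ unitary ℂ) (hv : v ∈ unitary ℂ) :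
    ⟪u - foot g u v, foot g u v - g⟫ = 0 := by
  have hu1 := mul_star_of_mem_unitary hu
  have hreflect := foot_sub_eq (g := g) hu hv
  have hchord := two_mul_foot_sub g u v
  unfold chordForm at hchord
  rw [inner_eq_zero_iff_mul_star]
  rw [star_sub] at hreflect
  rw [star_sub, star_sub]
  linear_combination (star u - star g) * hreflect
    + (star (foot g u v) - star g) * (v * hu1 - hchord)

/-- Reflection in the perpendicular turns the condition `h` into a linear equation for `a`. -/
lemma eq_foot_of_sub_eq (hag : a ≠ g) (hu : u ∈ unitary ℂ) (hperp : ⟪u - a, a - g⟫ = 0)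
    (h : a - g = u * v * star (a - g)) : a = foot g u v := by
  have hu1 := mul_star_of_mem_unitary hu
  have hne : star (a - g) ≠ 0 := star_ne_zero.2 (sub_ne_zero.2 hag)
  rw [inner_eq_zero_iff_mul_star] at hperp
  have key : u + v - a - u * v * star a = 0 := by
    apply mul_left_cancel₀ hne
    rw [star_sub u a] at hperp
    linear_combination hperp - (star u - star a) * h - v * star (a - g) * hu1
  rw [star_sub] at h
  unfold foot
  linear_combination (h - key) / 2

lemma exists_eq_foot (hag : a ≠ g) (hu : u ∈ unitary ℂ) (hperp : ⟪u - a, a - g⟫ = 0) :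
    ∃ v ∈ unitary ℂ, a = foot g u v := by
  have hne : a - g ≠ 0 := sub_ne_zero.2 hag
  have hne' : star (a - g) ≠ 0 := star_ne_zero.2 hne
  refine ⟨star u * ((a - g) / star (a - g)), ?_, eq_foot_of_sub_eq hag hu hperp ?_⟩
  · refine mul_mem (Unitary.star_mem hu) ?_
    rw [Unitary.mem_iff_self_mul_star, star_div₀, star_star]
    field_simp
  · rw [← mul_assoc, mul_star_of_mem_unitary hu, one_mul, div_mul_cancel₀ _ hne']

lemma eq_foot (hag : a ≠ g) (hu : u ∈ unitary ℂ) (hv : v ∈ unitary ℂ) (huv : u ≠ v)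
    (hperp_u : ⟪u - a, a - g⟫ = 0) (hperp_v : ⟪v - a, a - g⟫ = 0) : a = foot g u v := by
  refine eq_foot_of_sub_eq hag hu hperp_u (mul_left_cancel₀ (sub_ne_zero.2 huv) ?_)
  have hu1 := mul_star_of_mem_unitary hu
  have hv1 := mul_star_of_mem_unitary hv
  rw [inner_eq_zero_iff_mul_star, star_sub _ a] at hperp_u hperp_v
  linear_combination (u * v) * (hperp_v - hperp_u) + v * (a - g) * hu1 - u * (a - g) * hv1

lemma foot_right_injective (hu : u ∈ unitary ℂ) (hug : u ≠ g) : Function.Injective (foot g u) := by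
  intro v w h
  apply mul_left_cancel₀ (one_sub_mul_star_ne_zero hu hug)
  unfold foot at h
  linear_combination 2 * h

variable {S : EuclideanGeometry.Sphere ℂ}

/-- The locus of the feet of the tangents drawn from a focus of a conic is a circle. -/
lemma foot_mem_sphere_iff (hS : 0 ≤ S.radius) (hu : u ∈ unitary ℂ) (hv : v ∈ unitary ℂ) :
    foot g u v ∈ S ↔ IsTangentChord (2 * S.center - g) g (-4 * S.power g : ℝ) u v := by
  have hchord : chordForm u v (2 * S.center - g) * chordForm u v g
      = ((4 * (S.power (foot g u v) - S.power g) : ℝ) : ℂ) * (u * v) := by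
    have hreflect := foot_sub_eq (g := g) hu hv
    have hchord := two_mul_foot_sub g u v
    have hchord' : chordForm u v (2 * S.center - g)
        = 2 * (foot g u v - S.center) + 2 * (u * v) * star (g - S.center) := by
      unfold chordForm at *
      simp only [star_sub, star_mul', star_ofNat]
      linear_combination -hchord
    have hpower : ((S.power (foot g u v) - S.power g : ℝ) : ℂ)
        = (foot g u v - S.center) * star (foot g u v - S.center)
          - (g - S.center) * star (g - S.center) := by
      simp [EuclideanGeometry.Sphere.power, Complex.dist_eq, ← Complex.mul_conj']
    rw [Complex.ofReal_mul, hpower, hchord', ← hchord]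
    simp only [star_sub] at *
    push_cast
    linear_combination 4 * (foot g u v - S.center) * hreflect
  rw [← EuclideanGeometry.Sphere.power_eq_zero_iff_mem_sphere hS, IsTangentChord, hchord,
    mul_left_inj' (mul_ne_zero (ne_zero_of_mem_unitary hu) (ne_zero_of_mem_unitary hv)),
    Complex.ofReal_inj]
  constructor <;> intro h <;> linarith

lemma isTangentChord_of_mem_sphere (hg : g ∉ S) (hS : 0 ≤ S.radius) (ha : a ∈ S)
    (hu : u ∈ unitary ℂ) (hv : v ∈ unitary ℂ) (huv : u ≠ v)
    (hperp_u : ⟪u - a, a - g⟫ = 0) (hperp_v : ⟪v - a, a - g⟫ = 0) :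
    IsTangentChord (2 * S.center - g) g (-4 * S.power g : ℝ) u v := by
  rw [← foot_mem_sphere_iff hS hu hv,
    ← eq_foot (ne_of_mem_of_not_mem ha hg) hu hv huv hperp_u hperp_v]
  exact ha

/-- The relation between the unit circle and the circle `S` under which the triangles inscribed in
the unit circle whose sides have the feet of their perpendiculars from `g` on `S` close up. -/
def IsClosing (S : EuclideanGeometry.Sphere ℂ) (g : ℂ) : Prop :=
  (-4 * S.power g : ℝ) = (1 - (2 * S.center - g) * star (2 * S.center - g)) * (1 - g * star g)

lemma isClosing_of_triangle {t p : Fin 3 → ℂ} (hS : 0 ≤ S.radius) (hg : g ∉ S)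
    (ht : Function.Injective t) (ht_unit : ∀ i, t i ∈ unitary ℂ) (hp : ∀ i, p i ∈ S)
    (hperp : ∀ i j, j ≠ i → ⟪t j - p i, p i - g⟫ = 0) : IsClosing S g := by
  have tangent : ∀ i j k, j ≠ i → k ≠ i → j ≠ k →
      IsTangentChord (2 * S.center - g) g (-4 * S.power g : ℝ) (t j) (t k) :=
    fun i j k hji hki hjk => isTangentChord_of_mem_sphere hg hS (hp i) (ht_unit j) (ht_unit k)
      (ht.ne hjk) (hperp i j hji) (hperp i k hki)
  exact eq_of_isTangentChord (ne_zero_of_mem_unitary (ht_unit 2)) (ht.ne (by decide))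
    (ht.ne (by decide)) (ht.ne (by decide))
    (tangent 2 0 1 (by decide) (by decide) (by decide))
    (tangent 1 0 2 (by decide) (by decide) (by decide))
    (tangent 0 1 2 (by decide) (by decide) (by decide))

lemma IsClosing.ne (h : IsClosing S g) (hS : 0 ≤ S.radius) (hg : g ∉ S) (hu : u ∈ unitary ℂ) :
    u ≠ 2 * S.center - g ∧ u ≠ g := by
  have hpower : S.power g ≠ 0 :=
    (EuclideanGeometry.Sphere.power_eq_zero_iff_mem_sphere hS).not.2 hg
  have hne : ((-4 * S.power g : ℝ) : ℂ) ≠ 0 := by simpa using hpower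
  rw [h, mul_ne_zero_iff] at hne
  exact ⟨ne_of_one_sub_mul_star_ne_zero hu hne.1, ne_of_one_sub_mul_star_ne_zero hu hne.2⟩

lemma IsPonceletTriple.eq_foot_or_eq_foot (h : IsPonceletTriple (2 * S.center - g) g u v w)
    (hclosing : IsClosing S g) (hS : 0 ≤ S.radius) (hg : g ∉ S) {x : ℂ} (hx : x ∈ S)
    (hperp : ⟪u - x, x - g⟫ = 0) : x = foot g u v ∨ x = foot g u w := by
  obtain ⟨y, hy, rfl⟩ := exists_eq_foot (ne_of_mem_of_not_mem hx hg) h.mem_fst hperp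
  rw [foot_mem_sphere_iff hS h.mem_fst hy, hclosing] at hx
  obtain ⟨huf, hug⟩ := hclosing.ne hS hg h.mem_fst
  exact (h.eq_or_eq_of_isTangentChord huf hug hx).imp (congrArg _) (congrArg _)

lemma IsPonceletTriple.foot_mem_sphere (h : IsPonceletTriple (2 * S.center - g) g u v w)
    (hclosing : IsClosing S g) (hS : 0 ≤ S.radius) : foot g u v ∈ S := by
  rw [foot_mem_sphere_iff hS h.mem_fst h.mem_snd, hclosing]
  exact h.isTangentChord

theorem exists_third_vertex (hclosing : IsClosing S g) (hS : 0 ≤ S.radius) (hg : g ∉ S)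
    (hu : u ∈ unitary ℂ) (hv : v ∈ unitary ℂ) (huv : u ≠ v) (ha : a ∈ S)
    (hperp_u : ⟪u - a, a - g⟫ = 0) (hperp_v : ⟪v - a, a - g⟫ = 0) :
    ∃ w ∈ unitary ℂ, ∃ b ∈ S, ∃ c ∈ S, b ≠ c ∧
      ⟪v - b, b - g⟫ = 0 ∧ ⟪w - b, b - g⟫ = 0 ∧ ⟪u - c, c - g⟫ = 0 ∧ ⟪w - c, c - g⟫ = 0 ∧
      (∀ x ∈ S, ⟪u - x, x - g⟫ = 0 → x = a ∨ x = c) ∧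
      ∀ x ∈ S, ⟪v - x, x - g⟫ = 0 → x = a ∨ x = b := by
  have htangent := isTangentChord_of_mem_sphere hg hS ha hu hv huv hperp_u hperp_v
  rw [hclosing] at htangent
  obtain ⟨huf, hug⟩ := hclosing.ne hS hg hu
  obtain ⟨w, h⟩ := exists_isPonceletTriple huf hug hu hv htangent
  have hw := h.mem_trd
  obtain rfl := eq_foot (ne_of_mem_of_not_mem ha hg) hu hv huv hperp_u hperp_v
  refine ⟨w, hw, foot g v w, h.rotate.foot_mem_sphere hclosing hS, foot g u w, ?_, ?_,
    inner_sub_foot hv hw, ?_, inner_sub_foot hu hw, ?_, ?_, ?_⟩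
  · rw [foot_comm]
    exact h.rotate.rotate.foot_mem_sphere hclosing hS
  · rw [foot_comm g v, foot_comm g u]
    exact (foot_right_injective hw (hclosing.ne hS hg hw).2).ne huv.symm
  · rw [foot_comm]
    exact inner_sub_foot hw hv
  · rw [foot_comm]
    exact inner_sub_foot hw hu
  · exact fun x hx hperp => h.eq_foot_or_eq_foot hclosing hS hg hx hperp
  · rw [foot_comm g u]
    exact fun x hx hperp => h.swap.eq_foot_or_eq_foot hclosing hS hg hx hperp

end ComplexPlane

open EuclideanGeometry Module

section PerpLine

variable {A B D P Q X Y : Plane}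

lemma self_mem_perpLine (D A : Plane) : A ∈ perpLine D A :=
  Sphere.self_mem_orthRadius ⟨D, 0⟩ A

lemma mem_perpLine_iff : X ∈ perpLine D A ↔ ⟪X - A, A - D⟫ = 0 :=
  Sphere.mem_orthRadius_iff_inner_left (s := ⟨D, 0⟩)

lemma mem_ofDiameter_iff : A ∈ Sphere.ofDiameter X D ↔ X ∈ perpLine D A := by
  rw [← Sphere.angle_eq_pi_div_two_iff_mem_sphere_ofDiameter, angle,
    ← InnerProductGeometry.inner_eq_zero_iff_angle_eq_pi_div_two, mem_perpLine_iff,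
    ← neg_sub D A, inner_neg_right, neg_eq_zero, vsub_eq_sub, vsub_eq_sub]

lemma line_eq_perpLine (hA : A ≠ D) (hPQ : P ≠ Q) (hP : P ∈ perpLine D A)
    (hQ : Q ∈ perpLine D A) : line[ℝ, P, Q] = perpLine D A := by
  have hle : line[ℝ, P, Q] ≤ perpLine D A := affineSpan_pair_le_of_mem_of_mem hP hQ
  refine AffineSubspace.eq_of_direction_eq_of_nonempty_of_le ?_
    ⟨P, left_mem_affineSpan_pair ℝ P Q⟩ hle
  refine Submodule.eq_of_le_of_finrank_eq (AffineSubspace.direction_le hle) ?_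
  have hfinrank : finrank ℝ (perpLine D A).direction + 1 = finrank ℝ Plane :=
    Sphere.finrank_orthRadius (s := ⟨D, 0⟩) hA
  rw [finrank_euclideanSpace_fin] at hfinrank
  rw [direction_affineSpan, vectorSpan_pair, finrank_span_singleton (vsub_ne_zero.2 hPQ)]
  omega

lemma perpLine_inter_perpLine_subsingleton (hA : A ≠ D) (hB : B ≠ D) (hAB : A ≠ B) :
    ((perpLine D A : Set Plane) ∩ perpLine D B).Subsingleton := by
  intro P hP Q hQ
  by_contra hPQ
  have hlines : perpLine D A = perpLine D B :=
    (line_eq_perpLine hA hPQ hP.1 hQ.1).symm.trans (line_eq_perpLine hB hPQ hP.2 hQ.2)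
  exact hAB (Sphere.orthRadius_injective ⟨D, 0⟩ hlines)

lemma joinLine_eq_perpLine (hP : P ≠ D) (hX : X ∈ perpLine D P) :
    joinLine D P X = perpLine D P := by
  unfold joinLine
  split_ifs with h
  · rfl
  · exact line_eq_perpLine hP h (self_mem_perpLine D P) hX

lemma orthogonalProjection_eq_of_eq_perpLine {s : AffineSubspace ℝ Plane} [Nonempty s]
    (h : s = perpLine D A) : (orthogonalProjection s D : Plane) = A := by
  subst h
  exact Sphere.orthogonalProjection_orthRadius_center ⟨D, 0⟩ A

end PerpLine

section Triangle

variable {A D : Plane} {S S' : Sphere Plane} {T T' : Affine.Triangle ℝ Plane}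

lemma circumsphere_eq_of_forall_mem (h : ∀ i, T.points i ∈ S) : T.circumsphere = S := by
  have htop : affineSpan ℝ (Set.range T.points) = ⊤ :=
    T.independent.affineSpan_eq_top_iff_card_eq_finrank_add_one.2 (by simp)
  refine (T.circumsphere_unique_dist_eq.2 S ⟨htop ▸ AffineSubspace.mem_top ℝ Plane _, ?_⟩).symm
  rintro _ ⟨i, rfl⟩
  exact h i

lemma exists_triangle_circumsphere_eq {P Q R : Plane} (hP : P ∈ S) (hQ : Q ∈ S) (hR : R ∈ S)
    (hPQ : P ≠ Q) (hPR : P ≠ R) (hQR : Q ≠ R) :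
    ∃ t : Affine.Triangle ℝ Plane, t.points = ![P, Q, R] ∧ t.circumsphere = S := by
  refine ⟨⟨_, S.cospherical.affineIndependent_of_mem_of_ne hP hQ hR hPQ hPR hQR⟩, rfl,
    circumsphere_eq_of_forall_mem ?_⟩
  simp [Fin.forall_fin_succ, *]

lemma exists_compl_singleton_eq_pair (i : Fin 3) :
    ∃ j k, j ≠ i ∧ k ≠ i ∧ j ≠ k ∧ ({i}ᶜ : Set (Fin 3)) = {j, k} := by
  refine ⟨i + 1, i + 2, by decide +revert, by decide +revert, by decide +revert,
    Set.ext fun l => ?_⟩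
  rw [Set.mem_compl_iff, Set.mem_singleton_iff, Set.mem_insert_iff, Set.mem_singleton_iff]
  decide +revert

lemma IsNegativePedalTriangle.isPedalCircle (h : IsNegativePedalTriangle D T T')
    (hD : D ∉ T.circumsphere) : IsPedalCircle D T' T.circumsphere := by
  refine ⟨T, fun i => ?_, rfl⟩
  obtain ⟨j, k, hj, hk, hjk, hcompl⟩ := exists_compl_singleton_eq_pair i
  have hside : affineSpan ℝ (Set.range (T'.faceOpposite i).points) = perpLine D (T.points i) := by
    rw [T'.range_faceOpposite_points, hcompl, Set.image_pair]
    exact line_eq_perpLine (ne_of_mem_of_not_mem (T.mem_circumsphere i) hD)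
      (T'.independent.injective.ne hjk) (h i j hj) (h i k hk)
  exact (orthogonalProjection_eq_of_eq_perpLine hside).symm

theorem no_triangle_of_not_nontrivial (hA : ¬ ((perpLine D A : Set Plane) ∩ S').Nontrivial) :
    ¬ ∃ t t' : Affine.Triangle ℝ Plane, t.circumsphere = S ∧ A ∈ Set.range t.points ∧
      IsNegativePedalTriangle D t t' ∧ t'.circumsphere = S' := by
  rintro ⟨t, t', -, ⟨i, rfl⟩, h, rfl⟩
  obtain ⟨j, k, hj, hk, hjk, -⟩ := exists_compl_singleton_eq_pair i
  exact hA ⟨t'.points j, ⟨h i j hj, t'.mem_circumsphere j⟩, t'.points k,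
    ⟨h i k hk, t'.mem_circumsphere k⟩, t'.independent.injective.ne hjk⟩

end Triangle

section Coordinate

variable {S S' : Sphere Plane} {z m : ℂ}

/-- The point with complex coordinate `z` in the orthogonal coordinate system in which the circle
`S` is the unit circle. -/
noncomputable def ofCoordinate (S : Sphere Plane) (z : ℂ) : Plane :=
  S.center + S.radius • Complex.orthonormalBasisOneI.repr z

lemma ofCoordinate_surjective (hS : S.radius ≠ 0) : Function.Surjective (ofCoordinate S) := by
  intro X
  refine ⟨Complex.orthonormalBasisOneI.repr.symm (S.radius⁻¹ • (X - S.center)), ?_⟩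
  rw [ofCoordinate, LinearIsometryEquiv.apply_symm_apply, smul_inv_smul₀ hS, add_sub_cancel]

lemma ofCoordinate_sub_ofCoordinate (S : Sphere Plane) (x y : ℂ) :
    ofCoordinate S x - ofCoordinate S y
      = S.radius • Complex.orthonormalBasisOneI.repr (x - y) := by
  rw [ofCoordinate, ofCoordinate, add_sub_add_left_eq_sub, ← smul_sub, ← map_sub]

lemma dist_ofCoordinate (hS : 0 ≤ S.radius) (x y : ℂ) :
    dist (ofCoordinate S x) (ofCoordinate S y) = S.radius * dist x y := by
  rw [dist_eq_norm, ofCoordinate_sub_ofCoordinate, norm_smul, LinearIsometryEquiv.norm_map,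
    Real.norm_of_nonneg hS, dist_eq_norm]

lemma ofCoordinate_injective (hS : 0 < S.radius) : Function.Injective (ofCoordinate S) := by
  intro x y h
  have := dist_ofCoordinate hS.le x y
  rw [h, dist_self] at this
  simpa [hS.ne'] using this

lemma ofCoordinate_mem_perpLine_iff (hS : S.radius ≠ 0) {g a x : ℂ} :
    ofCoordinate S x ∈ perpLine (ofCoordinate S g) (ofCoordinate S a) ↔ ⟪x - a, a - g⟫ = 0 := by
  rw [mem_perpLine_iff, ofCoordinate_sub_ofCoordinate, ofCoordinate_sub_ofCoordinate,
    real_inner_smul_left, real_inner_smul_right, LinearIsometryEquiv.inner_map_map]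
  simp [hS]

lemma ofCoordinate_mem_iff (hS : 0 < S.radius) (hm : ofCoordinate S m = S'.center) :
    ofCoordinate S z ∈ S' ↔ z ∈ (⟨m, S'.radius / S.radius⟩ : Sphere ℂ) := by
  rw [mem_sphere, mem_sphere, ← hm, dist_ofCoordinate hS.le, eq_div_iff hS.ne', mul_comm]

lemma ofCoordinate_mem_self_iff (hS : 0 < S.radius) : ofCoordinate S z ∈ S ↔ z ∈ unitary ℂ := by
  have h0 : ofCoordinate S 0 = S.center := by simp [ofCoordinate]
  rw [ofCoordinate_mem_iff hS h0, div_self hS.ne', mem_sphere, dist_zero_right,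
    Unitary.mem_iff_self_mul_star, Complex.star_def, Complex.mul_conj', ← Complex.ofReal_pow,
    Complex.ofReal_eq_one, pow_eq_one_iff_of_nonneg (norm_nonneg z) two_ne_zero]

end Coordinate

section Porism

variable {A B' C' D : Plane} {T T' : Affine.Triangle ℝ Plane}

theorem IsNegativePedalTriangle.exists_third_vertex (hT' : IsNegativePedalTriangle D T T')
    (hD : D ∉ T.circumsphere) (hA : A ∈ T.circumsphere) (hne : B' ≠ C')
    (hB' : B' ∈ perpLine D A) (hB'S : B' ∈ T'.circumsphere)
    (hC' : C' ∈ perpLine D A) (hC'S : C' ∈ T'.circumsphere) :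
    ∃ A' ∈ T'.circumsphere, ∃ B ∈ T.circumsphere, ∃ C ∈ T.circumsphere, B ≠ C ∧
      C' ∈ perpLine D B ∧ A' ∈ perpLine D B ∧ B' ∈ perpLine D C ∧ A' ∈ perpLine D C ∧
      (∀ X ∈ T.circumsphere, B' ∈ perpLine D X → X = A ∨ X = C) ∧
      ∀ X ∈ T.circumsphere, C' ∈ perpLine D X → X = A ∨ X = B := by
  have hR : 0 < T'.circumsphere.radius := T'.circumradius_pos
  have hr : 0 < T.circumsphere.radius := T.circumradius_pos
  have hsurj := ofCoordinate_surjective hR.ne'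
  have hinj := ofCoordinate_injective hR
  obtain ⟨m, hm⟩ := hsurj T.circumsphere.center
  obtain ⟨g, rfl⟩ := hsurj D
  obtain ⟨a, rfl⟩ := hsurj A
  obtain ⟨u, rfl⟩ := hsurj B'
  obtain ⟨v, rfl⟩ := hsurj C'
  choose p hp using fun i => hsurj (T.points i)
  choose t ht using fun i => hsurj (T'.points i)
  have hclosing : IsClosing ⟨m, T.circumsphere.radius / T'.circumsphere.radius⟩ g := by
    refine isClosing_of_triangle (t := t) (p := p) (div_nonneg hr.le hR.le)
      ((ofCoordinate_mem_iff hR hm).not.1 hD) ?_ (fun i => ?_) (fun i => ?_) (fun i j hij => ?_)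
    · exact Function.Injective.of_comp (f := ofCoordinate T'.circumsphere)
        (by convert T'.independent.injective using 1; exact funext ht)
    · exact (ofCoordinate_mem_self_iff hR).1 (ht i ▸ T'.mem_circumsphere i)
    · exact (ofCoordinate_mem_iff hR hm).1 (hp i ▸ T.mem_circumsphere i)
    · exact (ofCoordinate_mem_perpLine_iff hR.ne').1 (ht j ▸ hp i ▸ hT' i j hij)
  simp only [hsurj.exists, hsurj.forall, hinj.eq_iff, hinj.ne_iff, ofCoordinate_mem_self_iff hR,
    ofCoordinate_mem_iff hR hm, ofCoordinate_mem_perpLine_iff hR.ne']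
    at hD hA hB' hB'S hC' hC'S hne ⊢
  exact PedalPorism.exists_third_vertex hclosing (div_nonneg hr.le hR.le) hD hB'S hC'S hne hA
    hB' hC'

lemma ofDiameter_inter_eq_pair {X C : Plane} {S : Sphere Plane} (hA : A ∈ S) (hC : C ∈ S)
    (hXA : X ∈ perpLine D A) (hXC : X ∈ perpLine D C)
    (h : ∀ Y ∈ S, X ∈ perpLine D Y → Y = A ∨ Y = C) :
    (Sphere.ofDiameter X D : Set Plane) ∩ S = {A, C} := by
  ext Y
  constructor
  · exact fun hY => h Y hY.2 (mem_ofDiameter_iff.1 hY.1)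
  · rintro (rfl | rfl)
    exacts [⟨mem_ofDiameter_iff.2 hXA, hA⟩, ⟨mem_ofDiameter_iff.2 hXC, hC⟩]

theorem IsNegativePedalTriangle.porism (hT' : IsNegativePedalTriangle D T T')
    (hD : D ∉ T.circumsphere) (hA : A ∈ T.circumsphere) (hne : B' ≠ C')
    (hB' : B' ∈ perpLine D A) (hB'S : B' ∈ T'.circumsphere)
    (hC' : C' ∈ perpLine D A) (hC'S : C' ∈ T'.circumsphere) :
    ∃ B C A' : Plane,
      (Sphere.ofDiameter B' D : Set Plane) ∩ T.circumsphere = {A, C} ∧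
      (Sphere.ofDiameter C' D : Set Plane) ∩ T.circumsphere = {A, B} ∧
      (joinLine D B C' : Set Plane) ∩ joinLine D C B' = {A'} ∧
      A' ∈ T'.circumsphere ∧
      (B ≠ A → C ≠ A → ∃ t : Affine.Triangle ℝ Plane,
        t.points = ![A', B', C'] ∧ t.circumsphere = T'.circumsphere ∧
        IsPedalCircle D t T.circumsphere) := by
  obtain ⟨A', hA'S, B, hB, C, hC, hBC, hC'B, hA'B, hB'C, hA'C, hB'_only, hC'_only⟩ :=
    hT'.exists_third_vertex hD hA hne hB' hB'S hC' hC'S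
  have ne_D : ∀ {X}, X ∈ T.circumsphere → X ≠ D := fun hX => ne_of_mem_of_not_mem hX hD
  refine ⟨B, C, A', ofDiameter_inter_eq_pair hA hC hB' hB'C hB'_only,
    ofDiameter_inter_eq_pair hA hB hC' hC'B hC'_only, ?_, hA'S, fun hBA hCA => ?_⟩
  · rw [joinLine_eq_perpLine (ne_D hB) hC'B, joinLine_eq_perpLine (ne_D hC) hB'C]
    exact (perpLine_inter_perpLine_subsingleton (ne_D hB) (ne_D hC) hBC).eq_singleton_of_mem
      ⟨hA'B, hA'C⟩
  · have hA'B' : A' ≠ B' := by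
      rintro rfl
      exact hne (perpLine_inter_perpLine_subsingleton (ne_D hA) (ne_D hB) hBA.symm
        ⟨hB', hA'B⟩ ⟨hC', hC'B⟩)
    have hA'C' : A' ≠ C' := by
      rintro rfl
      exact hne (perpLine_inter_perpLine_subsingleton (ne_D hA) (ne_D hC) hCA.symm
        ⟨hB', hB'C⟩ ⟨hC', hA'C⟩)
    obtain ⟨t, ht, htS⟩ := exists_triangle_circumsphere_eq hA'S hB'S hC'S hA'B' hA'C' hne
    obtain ⟨s, hs, hsS⟩ := exists_triangle_circumsphere_eq hA hB hC hBA.symm hCA.symm hBC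
    have hst : IsNegativePedalTriangle D s t := by
      intro i j hij
      rw [ht, hs]
      fin_cases i <;> fin_cases j <;> first | exact absurd rfl hij | assumption
    exact ⟨t, ht, htS, hsS ▸ hst.isPedalCircle (hsS ▸ hD)⟩

end Porism

section Secant

variable {V P : Type*} [NormedAddCommGroup V] [InnerProductSpace ℝ V] [MetricSpace P]
  [NormedAddTorsor V P] {s : AffineSubspace ℝ P} {S : Sphere P} {q x : P}

lemma dist_sq_eq_of_vsub_mem_orthogonal {c : P} (hq : q ∈ s) (horth : q -ᵥ c ∈ s.directionᗮ)
    (hx : x ∈ s) : dist x c ^ 2 = dist x q ^ 2 + dist q c ^ 2 := by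
  have hinner : ⟪x -ᵥ q, q -ᵥ c⟫ = 0 := horth _ (AffineSubspace.vsub_mem_direction hx hq)
  rw [dist_eq_norm_vsub V x q, dist_eq_norm_vsub V q, dist_eq_norm_vsub V x,
    ← vsub_add_vsub_cancel x q c, norm_add_sq_real, hinner, mul_zero, add_zero]

lemma inter_sphere_subsingleton_of_radius_le (hq : q ∈ s) (horth : q -ᵥ S.center ∈ s.directionᗮ)
    (hle : S.radius ≤ dist q S.center) : ((s : Set P) ∩ S).Subsingleton := by
  refine Set.subsingleton_of_forall_eq q fun x hx => dist_le_zero.1 ?_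
  have hpyth := dist_sq_eq_of_vsub_mem_orthogonal hq horth hx.1
  have hle_sq := pow_le_pow_left₀ (Sphere.radius_nonneg_of_mem hx.2) hle 2
  rw [mem_sphere.1 hx.2] at hpyth
  nlinarith

lemma inter_sphere_nontrivial_of_lt_radius (hs : s.direction ≠ ⊥) (hq : q ∈ s)
    (horth : q -ᵥ S.center ∈ s.directionᗮ) (hlt : dist q S.center < S.radius) :
    ((s : Set P) ∩ S).Nontrivial := by
  obtain ⟨v, hv, hv0⟩ := Submodule.exists_mem_ne_zero_of_ne_bot hs
  have hpos : 0 < S.radius ^ 2 - dist q S.center ^ 2 :=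
    sub_pos.2 (pow_lt_pow_left₀ hlt dist_nonneg two_ne_zero)
  obtain ⟨h, hh, hhv⟩ : ∃ h : ℝ, h ≠ 0 ∧ h ^ 2 * ‖v‖ ^ 2 = S.radius ^ 2 - dist q S.center ^ 2 := by
    refine ⟨√(S.radius ^ 2 - dist q S.center ^ 2) / ‖v‖, by positivity, ?_⟩
    rw [← mul_pow, div_mul_cancel₀ _ (norm_ne_zero_iff.2 hv0), Real.sq_sqrt hpos.le]
  have mem : ∀ k : ℝ, k ^ 2 = h ^ 2 → (k • v) +ᵥ q ∈ (s : Set P) ∩ S := by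
    intro k hk
    have hmem : (k • v) +ᵥ q ∈ s :=
      AffineSubspace.vadd_mem_of_mem_direction (Submodule.smul_mem _ k hv) hq
    refine ⟨hmem, mem_sphere.2 ?_⟩
    rw [← sq_eq_sq₀ dist_nonneg (dist_nonneg.trans hlt.le),
      dist_sq_eq_of_vsub_mem_orthogonal hq horth hmem, dist_vadd_left, norm_smul, mul_pow,
      Real.norm_eq_abs, sq_abs, hk, hhv, sub_add_cancel]
  refine ⟨_, mem h rfl, _, mem (-h) (neg_sq h), fun heq => hh ?_⟩
  have : h = -h := smul_left_injective ℝ hv0 (vadd_right_cancel q heq)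
  linarith

lemma perpLine_inter_sphere_nontrivial_iff {A D : Plane} {S : Sphere Plane} (hA : A ≠ D) :
    ((perpLine D A : Set Plane) ∩ S).Nontrivial ↔
      |⟪A - S.center, A - D⟫| < S.radius * ‖A - D‖ := by
  have hn : 0 < ‖A - D‖ := norm_sub_pos_iff.2 hA
  have hbot : (perpLine D A).direction ≠ ⊥ := by
    have hfinrank : finrank ℝ (perpLine D A).direction + 1 = finrank ℝ Plane :=
      Sphere.finrank_orthRadius (s := ⟨D, 0⟩) hA
    intro h
    rw [h, finrank_bot, finrank_euclideanSpace_fin] at hfinrank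
    omega
  set k := ⟪A - S.center, A - D⟫ / ‖A - D‖ ^ 2 with hk
  have hq : k • (A - D) + S.center ∈ perpLine D A := by
    rw [mem_perpLine_iff, add_sub_assoc, ← neg_sub A S.center, inner_add_left,
      real_inner_smul_left, real_inner_self_eq_norm_sq, hk, div_mul_cancel₀ _ (by positivity),
      inner_neg_left, add_neg_cancel]
  have horth : k • (A - D) + S.center -ᵥ S.center ∈ (perpLine D A).directionᗮ := by
    rw [perpLine, AffineSubspace.direction_mk', Submodule.orthogonal_orthogonal]
    simpa using Submodule.smul_mem _ k (Submodule.mem_span_singleton_self (A - D))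
  have hdist : dist (k • (A - D) + S.center) S.center = |⟪A - S.center, A - D⟫| / ‖A - D‖ := by
    rw [dist_eq_norm, add_sub_cancel_right, norm_smul, Real.norm_eq_abs, hk, abs_div,
      abs_of_nonneg (sq_nonneg ‖A - D‖)]
    field_simp
  rw [← div_lt_iff₀ hn, ← hdist]
  refine ⟨fun h => ?_, inter_sphere_nontrivial_of_lt_radius hbot hq horth⟩
  by_contra! hle
  exact h.not_subsingleton (inter_sphere_subsingleton_of_radius_le hq horth hle)

end Secant

section Conic

variable {γ : FocalConic} {A D P Q X n : Plane} {S S' : Sphere Plane}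
  {T T' : Affine.Triangle ℝ Plane}

lemma FocalConic.isTangent_iff_discrim_eq_zero {a b c : ℝ}
    (h : ∀ t : ℝ, γ.eqn (AffineMap.lineMap P Q t) = a * t ^ 2 + b * t + c) :
    γ.IsTangent P Q ↔ discrim a b c = 0 := by
  refine ⟨?_, fun h0 => ⟨a, b, c, h, h0⟩⟩
  rintro ⟨a', b', c', h', h0⟩
  have heq : ∀ t : ℝ, a * t ^ 2 + b * t + c = a' * t ^ 2 + b' * t + c' :=
    fun t => (h t).symm.trans (h' t)
  obtain rfl : c = c' := by linear_combination heq 0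
  obtain rfl : b = b' := by linear_combination (heq 1 - heq (-1)) / 2
  obtain rfl : a = a' := by linear_combination (heq 1 + heq (-1)) / 2
  exact h0

lemma discrim_norm_sq_sub_inner_sq (v x d : Plane) :
    discrim (‖d‖ ^ 2 - ⟪v, d⟫ ^ 2) (2 * (⟪x, d⟫ - ⟪v, x⟫ * ⟪v, d⟫)) (‖x‖ ^ 2 - ⟪v, x⟫ ^ 2)
      = 4 * (x 0 * d 1 - x 1 * d 0) ^ 2 * (‖v‖ ^ 2 - 1) := by
  simp only [discrim, EuclideanSpace.real_norm_sq_eq, PiLp.inner_apply, Fin.sum_univ_two,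
    RCLike.inner_apply, conj_trivial]
  ring

lemma det_ne_zero_of_inner {x d : Plane} (hx : ⟪n, x⟫ = 1) (hd : ⟪n, d⟫ = 0) (hd0 : d ≠ 0) :
    x 0 * d 1 - x 1 * d 0 ≠ 0 := by
  simp only [PiLp.inner_apply, Fin.sum_univ_two, RCLike.inner_apply, conj_trivial] at hx hd
  intro hdet
  have h0 : d 0 = 0 := by linear_combination -d 0 * hx + x 0 * hd - n 1 * hdet
  have h1 : d 1 = 0 := by linear_combination -d 1 * hx + x 1 * hd + n 0 * hdet
  exact hd0 (PiLp.ext (Fin.forall_fin_two.2 ⟨h0, h1⟩))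

/-- If the line `PQ` has equation `⟪n, X - F⟫ = 1`, homogenizing the equation of the conic with it
turns the restriction of the conic to the line into a quadratic form. -/
lemma FocalConic.eqn_eq_of_inner_eq_one (h : ⟪n, X - γ.focus⟫ = 1) :
    γ.eqn X = ‖X - γ.focus‖ ^ 2 - ⟪γ.p • n + γ.w, X - γ.focus⟫ ^ 2 := by
  rw [FocalConic.eqn, dist_eq_norm, inner_add_left, real_inner_smul_left, h, mul_one]

lemma FocalConic.isTangent_iff (hPQ : P ≠ Q) (hP : ⟪n, P - γ.focus⟫ = 1)
    (hQ : ⟪n, Q - γ.focus⟫ = 1) : γ.IsTangent P Q ↔ ‖γ.p • n + γ.w‖ = 1 := by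
  have hd : ⟪n, Q - P⟫ = 0 := by
    rw [← sub_sub_sub_cancel_right Q P γ.focus, inner_sub_right, hP, hQ, sub_self]
  have hdet := det_ne_zero_of_inner hP hd (sub_ne_zero.2 hPQ.symm)
  have hline (t : ℝ) :
      AffineMap.lineMap P Q t - γ.focus = (P - γ.focus) + t • (Q - P) := by
    rw [AffineMap.lineMap_apply, vadd_eq_add, vsub_eq_sub]
    abel
  rw [FocalConic.isTangent_iff_discrim_eq_zero fun t => ?_,
    discrim_norm_sq_sub_inner_sq (γ.p • n + γ.w) (P - γ.focus) (Q - P),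
    mul_eq_zero_iff_left (by positivity), sub_eq_zero,
    pow_eq_one_iff_of_nonneg (norm_nonneg _) two_ne_zero]
  rw [FocalConic.eqn_eq_of_inner_eq_one (n := n)
    (by rw [hline, inner_add_right, real_inner_smul_right, hP, hd, mul_zero, add_zero]), hline,
    norm_add_sq_real, inner_add_right, real_inner_smul_right, real_inner_smul_right, norm_smul,
    mul_pow, Real.norm_eq_abs, sq_abs]
  ring

/-- The circle into which the conic is transformed by duality: the locus of the points
`ℓ_P ∩ ℓ_Q`, where `ℓ_P` is the perpendicular at `P` to the line joining `P` to the focus, and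
`PQ` runs over the chords of `S` tangent to the conic. The focus is assumed not to lie
on `S`. -/
noncomputable def FocalConic.dualCircle (γ : FocalConic) (S : Sphere Plane) : Sphere Plane :=
  ⟨(2 : ℝ) • S.center - γ.focus + (S.power γ.focus / γ.p) • γ.w, |S.power γ.focus| / γ.p⟩

lemma inner_sub_eq_neg_power (hA : A ∈ S) (hX : X ∈ perpLine D A) :
    ⟪X - ((2 : ℝ) • S.center - D), A - D⟫ = -S.power D := by
  have hdiff (x y : Plane) : ⟪x - y, x + y⟫ = ‖x‖ ^ 2 - ‖y‖ ^ 2 := by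
    rw [inner_sub_left, inner_add_right, inner_add_right, real_inner_comm x y,
      real_inner_self_eq_norm_sq, real_inner_self_eq_norm_sq]
    ring
  calc ⟪X - ((2 : ℝ) • S.center - D), A - D⟫
      = ⟪X - A, A - D⟫ + ⟪(A - S.center) - (S.center - D), (A - S.center) + (S.center - D)⟫ := by
        rw [sub_add_sub_cancel A, ← inner_add_left, two_smul]
        congr 1
        abel
    _ = -S.power D := by
        rw [mem_perpLine_iff.1 hX, hdiff, ← dist_eq_norm, ← dist_eq_norm, mem_sphere.1 hA,
          dist_comm, Sphere.power]
        ring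

lemma power_ne_zero_of_notMem (hA : A ∈ S) (hD : D ∉ S) : S.power D ≠ 0 :=
  (Sphere.power_eq_zero_iff_mem_sphere (Sphere.radius_nonneg_of_mem hA)).not.2 hD

lemma FocalConic.isTangent_iff_mem_dualCircle (hP : P ∈ S) (hQ : Q ∈ S) (hPQ : P ≠ Q)
    (hF : γ.focus ∉ S) (hXP : X ∈ perpLine γ.focus P) (hXQ : X ∈ perpLine γ.focus Q) :
    γ.IsTangent P Q ↔ X ∈ γ.dualCircle S := by
  have hpow := power_ne_zero_of_notMem hP hF
  have hp := γ.p_pos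
  set F' := (2 : ℝ) • S.center - γ.focus
  -- The line `PQ` is the polar `⟪n, Y - F⟫ = 1` of `X`.
  set n := (-S.power γ.focus)⁻¹ • (X - F')
  have hn {Y : Plane} (hY : Y ∈ S) (hXY : X ∈ perpLine γ.focus Y) : ⟪n, Y - γ.focus⟫ = 1 := by
    rw [real_inner_smul_left, inner_sub_eq_neg_power hY hXY, inv_mul_cancel₀ (neg_ne_zero.2 hpow)]
  have hsmul : γ.p • n + γ.w
      = -(γ.p / S.power γ.focus) • (X - (F' + (S.power γ.focus / γ.p) • γ.w)) := by
    match_scalars <;> field_simp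
  rw [FocalConic.isTangent_iff hPQ (hn hP hXP) (hn hQ hXQ), hsmul, norm_smul, norm_neg,
    Real.norm_eq_abs, abs_div, abs_of_pos hp, mem_sphere, FocalConic.dualCircle, dist_eq_norm,
    div_mul_eq_mul_div, div_eq_one_iff_eq (abs_ne_zero.2 hpow), eq_div_iff hp.ne', mul_comm]

lemma FocalConic.isInscribedIn_iff (hT' : IsNegativePedalTriangle γ.focus T T')
    (hF : γ.focus ∉ T.circumsphere) :
    γ.IsInscribedIn T ↔ γ.dualCircle T.circumsphere = T'.circumsphere := by
  have hside {i j k : Fin 3} (hij : i ≠ j) (hki : k ≠ i) (hkj : k ≠ j) :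
      γ.IsTangent (T.points i) (T.points j) ↔ T'.points k ∈ γ.dualCircle T.circumsphere :=
    FocalConic.isTangent_iff_mem_dualCircle (T.mem_circumsphere i) (T.mem_circumsphere j)
      (T.independent.injective.ne hij) hF (hT' i k hki) (hT' j k hkj)
  constructor
  · intro h
    refine (circumsphere_eq_of_forall_mem fun k => ?_).symm
    obtain ⟨i, j, hi, hj, hij, -⟩ := exists_compl_singleton_eq_pair k
    exact (hside hij hi.symm hj.symm).1 (h i j hij)
  · intro h i j hij
    obtain ⟨k, hki, hkj⟩ : ∃ k : Fin 3, k ≠ i ∧ k ≠ j := by decide +revert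
    exact (hside hij hki hkj).2 (h ▸ T'.mem_circumsphere k)

lemma existsUnique_dualCircle_eq (hD : S.power D ≠ 0) (hS' : 0 < S'.radius) :
    ∃! γ : FocalConic, γ.focus = D ∧ γ.dualCircle S = S' := by
  refine ⟨⟨D, (|S.power D| / S'.radius / S.power D) • (S'.center - ((2 : ℝ) • S.center - D)),
    |S.power D| / S'.radius, by positivity⟩, ⟨rfl, ?_⟩, ?_⟩
  · ext1
    · simp only [FocalConic.dualCircle]
      rw [smul_smul, div_mul_div_cancel₀' hD, div_self (by positivity), one_smul, add_sub_cancel]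
    · exact div_div_cancel₀ (abs_ne_zero.2 hD)
  · rintro ⟨F, w, p, hp⟩ ⟨rfl, rfl⟩
    simp only [FocalConic.dualCircle, FocalConic.mk.injEq, true_and] at hD ⊢
    rw [div_div_cancel₀ (abs_ne_zero.2 hD), add_sub_cancel_left, smul_smul,
      div_mul_div_cancel₀ hD, div_self hp.ne', one_smul]
    exact ⟨rfl, rfl⟩

theorem IsNegativePedalTriangle.existsUnique_isInscribedIn
    (hT' : IsNegativePedalTriangle D T T') (hD : D ∉ T.circumsphere) :
    ∃! γ : FocalConic, γ.focus = D ∧ γ.IsInscribedIn T := by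
  have hiff (γ : FocalConic) : (γ.focus = D ∧ γ.IsInscribedIn T) ↔
      γ.focus = D ∧ γ.dualCircle T.circumsphere = T'.circumsphere :=
    and_congr_right fun hγ => by
      subst hγ
      exact FocalConic.isInscribedIn_iff hT' hD
  simp only [hiff]
  exact existsUnique_dualCircle_eq (power_ne_zero_of_notMem (T.mem_circumsphere 0) hD)
    T'.circumradius_pos

lemma FocalConic.mem_inside_union_carrier_iff :
    A ∈ γ.inside ∪ γ.carrier ↔ ‖A - γ.focus‖ ≤ |γ.p + ⟪γ.w, A - γ.focus⟫| := by
  change γ.eqn A < 0 ∨ γ.eqn A = 0 ↔ _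
  rw [← le_iff_lt_or_eq, FocalConic.eqn, sub_nonpos, sq_le_sq, abs_of_nonneg dist_nonneg,
    dist_eq_norm]

lemma FocalConic.inner_sub_center_dualCircle (hA : A ∈ S) :
    ⟪A - (γ.dualCircle S).center, A - γ.focus⟫
      = -(S.power γ.focus / γ.p) * (γ.p + ⟪γ.w, A - γ.focus⟫) := by
  have hp := γ.p_pos.ne'
  rw [FocalConic.dualCircle, ← sub_sub, inner_sub_left,
    inner_sub_eq_neg_power hA (self_mem_perpLine _ A), real_inner_smul_left]
  field_simp
  ring

theorem FocalConic.not_nontrivial_iff (hA : A ∈ S) (hF : γ.focus ∉ S) :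
    ¬ ((perpLine γ.focus A : Set Plane) ∩ γ.dualCircle S).Nontrivial ↔
      A ∈ γ.inside ∪ γ.carrier := by
  have hpos : 0 < |S.power γ.focus| / γ.p :=
    div_pos (abs_pos.2 (power_ne_zero_of_notMem hA hF)) γ.p_pos
  rw [perpLine_inter_sphere_nontrivial_iff (ne_of_mem_of_not_mem hA hF), not_lt,
    FocalConic.inner_sub_center_dualCircle hA, FocalConic.mem_inside_union_carrier_iff, abs_mul,
    abs_neg, abs_div, abs_of_pos γ.p_pos]
  exact mul_le_mul_iff_right₀ hpos

end Conic

end PedalPorism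

theorem mainTheorem3 (T : Affine.Triangle ℝ PedalPorism.Plane) (D : PedalPorism.Plane)
    (hDside : ∀ i j, i ≠ j → D ∉ line[ℝ, T.points i, T.points j])
    (hDcirc : D ∉ T.circumsphere)
    (T' : Affine.Triangle ℝ PedalPorism.Plane)
    (hT' : PedalPorism.IsNegativePedalTriangle D T T') :
    -- the porism
    (∀ A ∈ T.circumsphere, ∀ B' C' : PedalPorism.Plane, B' ≠ C' →
      B' ∈ PedalPorism.perpLine D A → B' ∈ T'.circumsphere →
      C' ∈ PedalPorism.perpLine D A → C' ∈ T'.circumsphere →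
      ∃ B C A' : PedalPorism.Plane,
        -- `A, C` and `A, B` are the intersections, counted with multiplicity
        (EuclideanGeometry.Sphere.ofDiameter B' D : Set PedalPorism.Plane) ∩ T.circumsphere
          = {A, C} ∧
        (EuclideanGeometry.Sphere.ofDiameter C' D : Set PedalPorism.Plane) ∩ T.circumsphere
          = {A, B} ∧
        (PedalPorism.joinLine D B C' : Set PedalPorism.Plane) ∩ PedalPorism.joinLine D C B'
          = {A'} ∧
        A' ∈ T'.circumsphere ∧
        (B ≠ A → C ≠ A → ∃ t : Affine.Triangle ℝ PedalPorism.Plane,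
          t.points = ![A', B', C'] ∧ t.circumsphere = T'.circumsphere ∧
          PedalPorism.IsPedalCircle D t T.circumsphere)) ∧
    -- `C` is the pedal circle of the negative-pedal triangle of `T`
    PedalPorism.IsPedalCircle D T' T.circumsphere ∧
    -- when the perpendicular at `A` does not meet the negative-pedal circle in two points,
    -- no triangle with a vertex in `A` exists
    (∀ A ∈ T.circumsphere,
      ¬ ((PedalPorism.perpLine D A : Set PedalPorism.Plane) ∩ T'.circumsphere).Nontrivial →
      ¬ ∃ t t' : Affine.Triangle ℝ PedalPorism.Plane,
        t.circumsphere = T.circumsphere ∧ A ∈ Set.range t.points ∧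
        PedalPorism.IsNegativePedalTriangle D t t' ∧ t'.circumsphere = T'.circumsphere) ∧
    -- and this occurs exactly inside or on the conic inscribed in `T` with focus `D`
    (∃! γ : PedalPorism.FocalConic, γ.focus = D ∧ γ.IsInscribedIn T) ∧
    (∀ γ : PedalPorism.FocalConic, γ.focus = D → γ.IsInscribedIn T →
      ∀ A ∈ T.circumsphere,
        (¬ ((PedalPorism.perpLine D A : Set PedalPorism.Plane) ∩ T'.circumsphere).Nontrivial ↔
          A ∈ γ.inside ∪ γ.carrier)) :=
  ⟨fun _ hA _ _ hne hB' hB'S hC' hC'S => hT'.porism hDcirc hA hne hB' hB'S hC' hC'S,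
    hT'.isPedalCircle hDcirc,
    fun _ _ hA => PedalPorism.no_triangle_of_not_nontrivial hA,
    hT'.existsUnique_isInscribedIn hDcirc,
    fun γ hγ h A hA => by
      subst hγ
      rw [← (PedalPorism.FocalConic.isInscribedIn_iff hT' hDcirc).1 h]
      exact PedalPorism.FocalConic.not_nontrivial_iff hA hDcirc⟩
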